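/- Let $(I,\le)$ be a finite partially ordered set with $|I|\ge 2$. For each $i\in I$ let $\Delta_i$ be a finite set with at least two elements, and let $\mathrm{Sym}(\Delta_i)$ act naturally on $\Delta_i$. Put $A(i)=\{j\in I: j>i\}$, $\Delta=\prod_{i\in I}\Delta_i$ and $\Delta_{A(i)}=\prod_{j>i}\Delta_j$ (a one-point set if $A(i)=\emptyset$), and let $F$ be the generalised wreath product of the permutation groups $(\mathrm{Sym}(\Delta_i),\Delta_i)_{i\in I}$; that is, $F$ is the set of all families $f=(f_i)_{i\in I}$ of functions $f_i:\Delta_{A(i)}\to \mathrm{Sym}(\Delta_i)$, acting on $\Delta$ by $$(f\cdot\delta)_i=f_i\big((\delta_j)_{j>i}\big)(\delta_i)\qquad(i\in I,\ \delta\in\Delta),$$ with the group operation given by composition of these maps; explicitly, $(fh)_i(\omega)=f_i(h\cdot\omega)\,h_i(\omega)$ for $\omega\in\Delta_{A(i)}$, where $h$ acts on $\Delta_{A(i)}$ by the same formula, restricted to the coordinates $j>i$. Then the minimum number $d(F)$ of generators of $F$ is $$d(F)=|I|.$$ -/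

import Mathlib

/-- The elements of the generalised wreath product of the groups `G i` acting on the sets `Δ i`,
indexed by a partially ordered set `I`: families `f = (f i)`, where `f i` is a function from
`∏_{j > i} Δ j` to `G i`. -/
@[ext]
structure GenWreath {I : Type*} [PartialOrder I] (G : I → Type*) (Δ : I → Type*) where
  /-- The component of `f` at `i`. -/
  comp : ∀ i : I, ((j : {j : I // i < j}) → Δ j) → G i

namespace GenWreath

variable {I : Type*} [PartialOrder I] {G : I → Type*} {Δ : I → Type*}

/-- The projection of a point of `∏_{k > i} Δ k` to `∏_{k > j} Δ k`, where `i < j`. -/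
def restrict {i j : I} (hij : i < j) (ω : (k : {k : I // i < k}) → Δ k) :
    (k : {k : I // j < k}) → Δ k :=
  fun k => ω ⟨k, hij.trans k.2⟩

/-- The projection of a point of `∏_k Δ k` to `∏_{k > i} Δ k`. -/
def proj (i : I) (δ : (k : I) → Δ k) : (k : {k : I // i < k}) → Δ k :=
  fun k => δ k

variable [∀ i, Group (G i)]

instance : One (GenWreath G Δ) := ⟨⟨fun _ _ => 1⟩⟩

theorem one_comp (i : I) (ω : (j : {j : I // i < j}) → Δ j) :
    (1 : GenWreath G Δ).comp i ω = 1 := rfl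

variable [∀ i, MulAction (G i) (Δ i)]

/-- The map that `f` induces on `∏_{j > i} Δ j`. -/
def actAbove (f : GenWreath G Δ) (i : I) (ω : (j : {j : I // i < j}) → Δ j) :
    (j : {j : I // i < j}) → Δ j :=
  fun j => f.comp j (restrict j.2 ω) • ω j

/-- The map that `f` induces on `∏_i Δ i`. -/
def act (f : GenWreath G Δ) (δ : (i : I) → Δ i) : (i : I) → Δ i :=
  fun i => f.comp i (proj i δ) • δ i

/-- The product: `f * h` acts as `h` followed by `f`. -/
instance : Mul (GenWreath G Δ) :=
  ⟨fun f h => ⟨fun i ω => f.comp i (h.actAbove i ω) * h.comp i ω⟩⟩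

/-- The components of the inverse, by recursion from the top of `I` downwards. -/
def invComp [WellFoundedGT I] (f : GenWreath G Δ) (i : I)
    (ω : (j : {j : I // i < j}) → Δ j) : G i :=
  (f.comp i (fun j => invComp f j.1 (restrict j.2 ω) • ω j))⁻¹
termination_by wellFounded_gt.wrap i
decreasing_by exact j.2

instance [WellFoundedGT I] : Inv (GenWreath G Δ) := ⟨fun f => ⟨f.invComp⟩⟩

theorem mul_comp (f h : GenWreath G Δ) (i : I) (ω : (j : {j : I // i < j}) → Δ j) :
    (f * h).comp i ω = f.comp i (h.actAbove i ω) * h.comp i ω := rfl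

theorem one_actAbove (i : I) (ω : (j : {j : I // i < j}) → Δ j) :
    (1 : GenWreath G Δ).actAbove i ω = ω := by
  funext j
  simp [actAbove, one_comp]

theorem mul_actAbove (f h : GenWreath G Δ) (i : I) (ω : (j : {j : I // i < j}) → Δ j) :
    (f * h).actAbove i ω = f.actAbove i (h.actAbove i ω) := by
  funext j
  simp only [actAbove, mul_comp, mul_smul]
  rfl

theorem inv_comp [WellFoundedGT I] (f : GenWreath G Δ) (i : I)
    (ω : (j : {j : I // i < j}) → Δ j) :
    (f⁻¹).comp i ω = (f.comp i ((f⁻¹).actAbove i ω))⁻¹ := by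
  change invComp f i ω = _
  rw [invComp]
  rfl

instance [WellFoundedGT I] : Group (GenWreath G Δ) :=
  Group.ofRightAxioms
    (fun f g h => by
      ext i ω
      simp only [mul_comp, mul_actAbove, mul_assoc])
    (fun f => by
      ext i ω
      simp only [mul_comp, one_actAbove, one_comp, mul_one])
    (fun f => by
      ext i ω
      simp only [mul_comp, inv_comp f i ω, mul_inv_cancel, one_comp])

/-- The action of the generalised wreath product on `Δ = ∏_i Δ i`. -/
instance [WellFoundedGT I] : MulAction (GenWreath G Δ) ((i : I) → Δ i) where
  smul := act
  one_smul δ := by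
    funext i
    exact one_smul (G i) (δ i)
  mul_smul f h δ := by
    funext i
    exact mul_smul (f.comp i (h.actAbove i (proj i δ))) (h.comp i (proj i δ)) (δ i)

instance [Finite I] [∀ i, Finite (G i)] [∀ i, Finite (Δ i)] : Finite (GenWreath G Δ) :=
  Finite.of_injective comp (fun _ _ h => GenWreath.ext h)

end GenWreath

/-!
For the lower bound, multiplying the signs of all values of the component at `i` gives a
homomorphism to `ℤˣ`, and together these map `F` onto `ℤˣ ^ I`, which needs `|I|` generators.

For the upper bound, consider for each upper set `S` of `I` the subgroup of the elements whose
components outside `S` are trivial, and enlarge `S` one minimal element `i` at a time. Elements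
concentrated at `i` and at one point `ω` of `∏_{j > i} Δ j` form a copy of `Sym (Δ i)`; since the
subgroup of `S` is transitive on these points, it suffices to generate one such copy. One new
generator is enough for this: multiply an old generator `x` by a cycle `c` at `ω`, and add a
transposition `s` at `ω`. Conjugating by `x * c` along the orbit of `ω` under `x` shows that the
part of the copy which has been generated is normalised by `c`; so it is everything, and `x` can
be recovered.

One generator must be saved at the beginning, with `S = {i, t}` and `t` maximal. If `|Δ t| = 2`,
then `Sym (Δ t)` is cyclic. Otherwise take a full cycle `ρ` of `Δ t`, a point `p` of `Δ t`, the
transposition `σ = (ρ p, ρ (ρ p))`, which fixes `p`, and generators `c`, `τ` of `Sym (Δ i)` with `c`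
of odd order, both placed over `p`. Then `σ` and `c` commute and have coprime orders, so both are
powers of `σ * c`. Conjugation by `ρ * τ` agrees with conjugation by `ρ` on the permutations of
`Δ t` fixing `p`; hence it carries `σ` step by step to all transpositions `(x, ρ x)` with `x ≠ p`,
and these generate `Sym (Δ t)`.
-/

theorem isUpperSet_singleton_of_isMax {α : Type*} [PartialOrder α] {a : α} (ha : IsMax a) :
    IsUpperSet {a} := by
  rintro b c hbc rfl
  exact (ha.eq_of_le hbc).symm

section Group

open Subgroup

variable {G : Type*} [Group G]

theorem subgroup_eq_top_of_conj_mem [Finite G] {L : Subgroup G} {c s : G}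
    (hgen : closure {c, s} = ⊤) (hnormal : normalClosure {s} = ⊤) (hs : s ∈ L)
    (hc : ∀ g ∈ L, c * g * c⁻¹ ∈ L) : L = ⊤ := by
  have hL : normalizer (L : Set G) = ⊤ := by
    rw [eq_top_iff, ← hgen, closure_le]
    rintro _ (rfl | rfl)
    exacts [mem_normalizer_fintype hc, le_normalizer hs]
  have := normalizer_eq_top_iff.1 hL
  rw [eq_top_iff, ← hnormal]
  exact normalClosure_le_normal (Set.singleton_subset_iff.2 hs)

theorem mul_mul_mul_inv_eq_of_commute {b x : G} (h : Commute b x) (a : G) :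
    a * b * x * (a * b)⁻¹ = a * x * a⁻¹ := by
  rw [mul_assoc a b x, h.eq]
  group

theorem left_mem_of_mul_mem_of_coprime_orderOf {H : Subgroup G} {a b : G} (hab : Commute a b)
    (hcop : (orderOf a).Coprime (orderOf b)) (hmem : a * b ∈ H) : a ∈ H := by
  obtain ⟨m, hm⟩ := exists_pow_eq_self_of_coprime hcop.symm
  have hpow : (a * b) ^ orderOf b = a ^ orderOf b := by
    rw [hab.mul_pow, pow_orderOf_eq_one, mul_one]
  rw [← hm, ← hpow]
  exact H.pow_mem (H.pow_mem hmem _) _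

theorem rank_le_natCard_of_closure_range_eq_top [Group.FG G] {ι : Type*} [Finite ι] {g : ι → G}
    (hg : closure (Set.range g) = ⊤) : Group.rank G ≤ Nat.card ι := by
  classical
  have := Fintype.ofFinite ι
  rw [← Set.image_univ, ← Finset.coe_univ, ← Finset.coe_image] at hg
  rw [Nat.card_eq_fintype_card]
  exact (Group.rank_le hg).trans Finset.card_image_le

theorem natCard_le_rank_pi_units_int (ι : Type*) [Finite ι] :
    Nat.card ι ≤ Group.rank (ι → ℤˣ) := by
  have := Fintype.ofFinite ι
  have hcard := card_dvd_exponent_pow_rank' (ι → ℤˣ) (n := 2) fun u =>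
    funext fun i => Int.units_sq (u i)
  rw [Nat.card_fun, Nat.card_eq_fintype_card (α := ℤˣ), Fintype.card_units_int] at hcard
  exact (Nat.pow_dvd_pow_iff_le_right one_lt_two).1 hcard

end Group

section Perm

open Equiv Equiv.Perm

variable {α : Type*}

/- The step may fail at `a`: along the cycle from `f a`, it is needed only when returning to `a`,
where `first` applies again. -/
theorem sameCycle_induction [Finite α] {f : Perm α} {a b : α} {P : α → Prop}
    (hab : f.SameCycle a b) (first : P (f a)) (step : ∀ x ≠ a, P x → P (f x)) : P b := by
  obtain ⟨n, hn, -, rfl⟩ := hab.exists_pow_eq''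
  induction n, hn using Nat.le_induction with
  | base => simpa only [zero_add, pow_one] using first
  | succ n _ ih =>
    rw [pow_succ', Perm.mul_apply]
    by_cases hx : (f ^ n) a = a
    · rwa [hx]
    · exact step _ hx (ih ⟨n, by simp⟩)

theorem perm_subgroup_eq_top_of_forall_swap_mem [Finite α] [DecidableEq α] {M : Subgroup (Perm α)}
    {a : α} (hM : ∀ b, swap a b ∈ M) : M = ⊤ := by
  rw [eq_top_iff, ← closure_isSwap, Subgroup.closure_le]
  rintro _ ⟨b, c, -, rfl⟩
  exact SubmonoidClass.swap_mem_trans M (swap_comm a b ▸ hM b) (hM c)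

theorem normalClosure_swap_eq_top [Finite α] [DecidableEq α] {a b : α} (hab : a ≠ b) :
    Subgroup.normalClosure {swap a b} = ⊤ := by
  rw [eq_top_iff, ← closure_isSwap, Subgroup.closure_le]
  rintro _ ⟨c, d, hcd, rfl⟩
  exact Subgroup.conjugatesOfSet_subset_normalClosure
    (Group.mem_conjugatesOfSet_iff.2 ⟨_, rfl, isConj_swap hab hcd⟩)

variable [Fintype α] [DecidableEq α]

theorem exists_isCycle_support_eq_univ (α : Type*) [Fintype α] [DecidableEq α] [Nontrivial α] :
    ∃ ρ : Perm α, ρ.IsCycle ∧ ρ.support = Finset.univ := by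
  obtain ⟨ρ, hρ, -⟩ := Finset.exists_cycleOn (Finset.univ : Finset α)
  have hne : ∀ x, ρ x ≠ x := fun x =>
    hρ.apply_ne (by simpa only [Finset.coe_univ] using Set.nontrivial_univ) (Finset.mem_univ x)
  have hsupp : ρ.support = Finset.univ := Finset.eq_univ_of_forall fun x => mem_support.2 (hne x)
  refine ⟨ρ, isCycle_iff_exists_isCycleOn.2 ⟨_, ?_, hρ, fun x _ => Finset.mem_univ x⟩, hsupp⟩
  simpa only [Finset.coe_univ] using Set.nontrivial_univ

theorem odd_orderOf_of_isCycle_of_sign_eq_one {c : Perm α} (hc : c.IsCycle) (hsign : sign c = 1) :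
    Odd (orderOf c) := by
  rw [hc.sign, neg_eq_iff_eq_neg] at hsign
  rw [hc.orderOf, ← Nat.not_even_iff_odd]
  intro heven
  rw [heven.neg_one_pow] at hsign
  exact absurd hsign (by decide)

theorem exists_odd_orderOf_closure_pair_eq_top (α : Type*) [Finite α] [Nontrivial α] :
    ∃ c τ : Perm α, Odd (orderOf c) ∧ Subgroup.closure {c, τ} = ⊤ := by
  classical
  have := Fintype.ofFinite α
  obtain ⟨ρ, hρ, hsupp⟩ := exists_isCycle_support_eq_univ α
  obtain ⟨a⟩ : Nonempty α := inferInstance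
  have hne : ρ a ≠ a := mem_support.1 (hsupp ▸ Finset.mem_univ a)
  have hgen := closure_cycle_adjacent_swap hρ hsupp a
  rcases Int.units_eq_one_or (sign ρ) with hsign | hsign
  · exact ⟨ρ, _, odd_orderOf_of_isCycle_of_sign_eq_one hρ hsign, hgen⟩
  set τ := swap a (ρ a)
  refine ⟨τ * ρ, τ, ?_, ?_⟩
  · by_cases h2 : ρ (ρ a) = a
    · have hρτ : ρ = τ := hρ.eq_swap_of_apply_apply_eq_self hne h2
      rw [hρτ, swap_mul_self, orderOf_one]
      exact odd_one
    · refine odd_orderOf_of_isCycle_of_sign_eq_one (hρ.swap_mul hne h2) ?_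
      rw [Perm.sign_mul, hsign, sign_swap hne.symm, Int.units_mul_self]
  · rw [eq_top_iff, ← hgen, Subgroup.closure_le]
    have hτ : τ ∈ Subgroup.closure {τ * ρ, τ} := Subgroup.mem_closure_of_mem (by simp)
    have hτρ : τ * ρ ∈ Subgroup.closure {τ * ρ, τ} := Subgroup.mem_closure_of_mem (by simp)
    rintro _ (rfl | rfl)
    exacts [(Subgroup.mul_mem_cancel_left _ hτ).1 hτρ, hτ]

theorem exists_closure_pair_eq_top_normalClosure_eq_top (α : Type*) [Finite α] [Nontrivial α] :
    ∃ c s : Perm α, Subgroup.closure {c, s} = ⊤ ∧ Subgroup.normalClosure {s} = ⊤ := by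
  classical
  have := Fintype.ofFinite α
  obtain ⟨ρ, hρ, hsupp⟩ := exists_isCycle_support_eq_univ α
  obtain ⟨a⟩ : Nonempty α := inferInstance
  have hne : ρ a ≠ a := mem_support.1 (hsupp ▸ Finset.mem_univ a)
  exact ⟨ρ, _, closure_cycle_adjacent_swap hρ hsupp a, normalClosure_swap_eq_top hne.symm⟩

theorem perm_subgroup_eq_top_of_conj_stabilizer_mem {M : Subgroup (Perm α)} {ρ : Perm α}
    (hρ : ρ.IsCycle) (hsupp : ρ.support = Finset.univ) {p : α}
    (hswap : swap (ρ p) (ρ (ρ p)) ∈ M) (hconj : ∀ π ∈ M, π p = p → ρ * π * ρ⁻¹ ∈ M) :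
    M = ⊤ := by
  have hne : ∀ x, ρ x ≠ x := fun x => mem_support.1 (hsupp ▸ Finset.mem_univ x)
  have hcycle : ∀ x, ρ.SameCycle p x := fun x => hρ.sameCycle (hne p) (hne x)
  have hadjacent : ∀ x, x ≠ p → swap x (ρ x) ∈ M := fun x =>
    sameCycle_induction (P := fun x => x ≠ p → swap x (ρ x) ∈ M) (hcycle x) (fun _ => hswap)
      fun x hx ih hρx => by
        rw [swap_apply_apply]
        exact hconj _ (ih hx) (swap_apply_of_ne_of_ne hx.symm hρx.symm)
  refine perm_subgroup_eq_top_of_forall_swap_mem (a := ρ p) fun x =>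
    sameCycle_induction (P := fun x => swap (ρ p) x ∈ M) (hcycle x) ?_ fun x hx ih =>
      SubmonoidClass.swap_mem_trans M ih (hadjacent x hx)
  exact swap_self (ρ p) ▸ M.one_mem

end Perm

namespace GenWreath

variable {I : Type*} [PartialOrder I] {G : I → Type*} {Δ : I → Type*}

/-- The product `∏_{k > i} Δ k`, on which the component at `i` of an element of the generalised
wreath product is a function. -/
abbrev Above (Δ : I → Type*) (i : I) : Type _ := (k : {k : I // i < k}) → Δ k

variable [∀ i, Group (G i)] [∀ i, MulAction (G i) (Δ i)]

theorem mulSingle_actAbove [DecidableEq I] {i j : I} (hji : ¬ j < i) (φ : Above Δ i → G i)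
    (ω : Above Δ j) : (⟨Pi.mulSingle i φ⟩ : GenWreath G Δ).actAbove j ω = ω := by
  funext k
  have hk : (k : I) ≠ i := fun h => hji (h ▸ k.2)
  simp [actAbove, Pi.mulSingle_eq_of_ne hk]

section WellFounded

variable [WellFoundedGT I]

/-- The permutation of `∏_{k > i} Δ k` that `f` induces. -/
def permAbove (f : GenWreath G Δ) (i : I) : Equiv.Perm (Above Δ i) where
  toFun := f.actAbove i
  invFun := f⁻¹.actAbove i
  left_inv ω := by rw [← mul_actAbove, inv_mul_cancel, one_actAbove]
  right_inv ω := by rw [← mul_actAbove, mul_inv_cancel, one_actAbove]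

variable (G Δ) in
/-- The subgroup of the elements whose components outside `S` are trivial. -/
def supported (S : Set I) : Subgroup (GenWreath G Δ) where
  carrier := {f | ∀ j ∉ S, ∀ ω, f.comp j ω = 1}
  one_mem' _ _ _ := rfl
  mul_mem' {f h} hf hh j hj ω := by rw [mul_comp, hf j hj, hh j hj, one_mul]
  inv_mem' {f} hf j hj ω := by rw [inv_comp, hf j hj, inv_one]

theorem supported_mono {S T : Set I} (h : S ⊆ T) : supported G Δ S ≤ supported G Δ T :=
  fun _ hf j hj => hf j (Set.notMem_subset h hj)

theorem supported_empty : supported G Δ ∅ = ⊥ :=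
  (Subgroup.eq_bot_iff_forall _).2 fun _ hf =>
    GenWreath.ext (funext fun j => funext fun ω => hf j (Set.notMem_empty j) ω)

theorem supported_univ : supported G Δ Set.univ = ⊤ :=
  eq_top_iff.2 fun _ _ j hj => absurd (Set.mem_univ j) hj

theorem supported_le_supported_compl_Iic {S : Set I} {i : I} (hS : IsUpperSet S) (hi : i ∉ S) :
    supported G Δ S ≤ supported G Δ (Set.Iic i)ᶜ :=
  supported_mono fun _ hj hji => hi (hS hji hj)

open scoped Classical in
/-- The embedding of the functions `∏_{k > i} Δ k → G i` as the elements whose components other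
than the one at `i` are trivial. -/
noncomputable def single (i : I) : (Above Δ i → G i) →* GenWreath G Δ where
  toFun φ := ⟨Pi.mulSingle i φ⟩
  map_one' := by
    rw [Pi.mulSingle_one]
    rfl
  map_mul' φ ψ := by
    ext j ω
    rw [mul_comp]
    obtain rfl | hj := eq_or_ne j i
    · rw [mulSingle_actAbove (lt_irrefl j)]
      simp
    · simp [Pi.mulSingle_eq_of_ne hj]

theorem single_comp_same (i : I) (φ : Above Δ i → G i) : (single i φ).comp i = φ := by
  classical
  exact Pi.mulSingle_eq_same (M := fun j => Above Δ j → G j) i φ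

theorem single_comp_of_ne {i j : I} (hji : j ≠ i) (φ : Above Δ i → G i) (ω : Above Δ j) :
    (single i φ).comp j ω = 1 := by
  classical
  exact congrFun (Pi.mulSingle_eq_of_ne (M := fun j => Above Δ j → G j) hji φ) ω

theorem single_actAbove {i j : I} (hji : ¬ j < i) (φ : Above Δ i → G i) (ω : Above Δ j) :
    (single i φ).actAbove j ω = ω := by
  classical
  exact mulSingle_actAbove hji φ ω

theorem single_mem_supported {i : I} {S : Set I} (hi : i ∈ S) (φ : Above Δ i → G i) :
    single i φ ∈ supported G Δ S :=
  fun _ hj => single_comp_of_ne (ne_of_mem_of_not_mem hi hj).symm φ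

theorem mul_single_mul_inv {i : I} {g : GenWreath G Δ} (hg : g ∈ supported G Δ (Set.Iic i)ᶜ)
    (φ : Above Δ i → G i) : g * single i φ * g⁻¹ = single i (φ ∘ (g.permAbove i).symm) := by
  have hg_comp : ∀ j ≤ i, ∀ ω, g.comp j ω = 1 := fun j hj => hg j (not_not_intro hj)
  rw [mul_inv_eq_iff_eq_mul]
  ext j ω
  rw [mul_comp, mul_comp]
  obtain rfl | hj := eq_or_ne j i
  · rw [hg_comp j le_rfl, hg_comp j le_rfl, single_comp_same, single_comp_same, one_mul, mul_one]
    exact congrArg φ ((g.permAbove j).symm_apply_apply ω).symm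
  · rw [single_comp_of_ne hj, single_comp_of_ne hj, mul_one, one_mul]
    by_cases hlt : j < i
    · rw [hg_comp j hlt.le, hg_comp j hlt.le]
    · rw [single_actAbove hlt]

theorem supported_insert_le_sup (S : Set I) (i : I) :
    supported G Δ (insert i S) ≤ supported G Δ S ⊔ (single i).range := by
  intro f hf
  have hrest : f * (single i (f.comp i))⁻¹ ∈ supported G Δ S := by
    intro j hj ω
    rw [← map_inv, mul_comp]
    obtain rfl | hji := eq_or_ne j i
    · rw [single_actAbove (lt_irrefl j), single_comp_same, Pi.inv_apply, mul_inv_cancel]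
    · rw [single_comp_of_ne hji, mul_one, hf j (by simp [hji, hj])]
  rw [← inv_mul_cancel_right f (single i (f.comp i))]
  exact Subgroup.mul_mem_sup hrest ⟨_, rfl⟩

open scoped Classical in
/-- The copy of `G i` formed by the elements whose only nontrivial value is the value at `ω` of
the component at `i`. -/
noncomputable def singleAt (i : I) (ω : Above Δ i) : G i →* GenWreath G Δ :=
  (single i).comp (MonoidHom.mulSingle (fun _ => G i) ω)

theorem singleAt_mem_supported {i : I} {S : Set I} (hi : i ∈ S) (ω : Above Δ i) (a : G i) :
    singleAt i ω a ∈ supported G Δ S :=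
  single_mem_supported hi _

theorem mul_singleAt_mul_inv {i : I} {g : GenWreath G Δ} (hg : g ∈ supported G Δ (Set.Iic i)ᶜ)
    (ω : Above Δ i) (a : G i) :
    g * singleAt i ω a * g⁻¹ = singleAt i (g.actAbove i ω) a := by
  classical
  refine (mul_single_mul_inv hg _).trans (congrArg (single i) (funext fun ω' => ?_))
  simp only [MonoidHom.mulSingle_apply, Function.comp_apply, Pi.mulSingle_apply,
    Equiv.symm_apply_eq]
  rfl

theorem commute_singleAt_of_ne {i : I} {ω ω' : Above Δ i} (hω : ω ≠ ω') (a b : G i) :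
    Commute (singleAt i ω a) (singleAt i ω' b) := by
  classical
  exact (Pi.mulSingle_commute hω a b).map (single i)

theorem commute_singleAt_of_smul_eq {t i : I} (hti : ¬ t ≤ i) (p : ∀ j, Δ j) {a : G t}
    (ha : a • p t = p t) (b : G i) :
    Commute (singleAt t (proj t p) a) (singleAt i (proj i p) b) := by
  classical
  have hfix : (singleAt t (proj t p) a).actAbove i (proj i p) = proj i p := by
    funext ⟨k, hk⟩
    obtain rfl | hkt := eq_or_ne k t
    · change (single k _).comp k (proj k p) • p k = p k
      rwa [single_comp_same, MonoidHom.mulSingle_apply, Pi.mulSingle_eq_same]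
    · change (single t _).comp k (proj k p) • p k = p k
      rw [single_comp_of_ne hkt, one_smul]
  have hconj := mul_singleAt_mul_inv (g := singleAt t (proj t p) a)
    (singleAt_mem_supported (S := (Set.Iic i)ᶜ) hti _ a) (proj i p) b
  rwa [hfix, mul_inv_eq_iff_eq_mul] at hconj

theorem exists_mem_supported_actAbove_eq [∀ i, MulAction.IsPretransitive (G i) (Δ i)] {S : Set I}
    {i : I} (hiS : Set.Ioi i ⊆ S) (ω ω' : Above Δ i) :
    ∃ g ∈ supported G Δ S, g.actAbove i ω = ω' := by
  classical
  choose a ha using fun k : {k // i < k} =>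
    MulAction.exists_smul_eq (G k) (ω k) (ω' k)
  refine ⟨⟨fun j _ => if h : i < j then a ⟨j, h⟩ else 1⟩, fun j hj _ => ?_, funext fun k => ?_⟩
  · exact dif_neg fun h => hj (hiS h)
  · change (if h : i < k.1 then a ⟨k, h⟩ else 1 : G k.1) • ω k = ω' k
    rw [dif_pos k.2, ha k]

end WellFounded

section Finite

variable [Finite I] [∀ i, Finite (Δ i)]

theorem single_range_le {H : Subgroup (GenWreath G Δ)} {i : I}
    (hH : ∀ ω, (singleAt i ω).range ≤ H) : (single i).range ≤ H := by
  classical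
  rintro _ ⟨φ, rfl⟩
  exact Subgroup.pi_mem_of_mulSingle_mem (H := H.comap (single i)) φ fun ω => hH ω ⟨φ ω, rfl⟩

theorem supported_insert_le [∀ i, MulAction.IsPretransitive (G i) (Δ i)] {S : Set I} {i : I}
    (hS : IsUpperSet S) (hi : i ∉ S) (hiS : Set.Ioi i ⊆ S) {H : Subgroup (GenWreath G Δ)}
    (hSH : supported G Δ S ≤ H) {ω : Above Δ i} (hω : (singleAt i ω).range ≤ H) :
    supported G Δ (insert i S) ≤ H := by
  refine (supported_insert_le_sup S i).trans (sup_le hSH (single_range_le fun ω' => ?_))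
  rintro _ ⟨a, rfl⟩
  obtain ⟨g, hg, rfl⟩ := exists_mem_supported_actAbove_eq (G := G) hiS ω ω'
  rw [← mul_singleAt_mul_inv (supported_le_supported_compl_Iic hS hi hg)]
  exact H.mul_mem (H.mul_mem (hSH hg) (hω ⟨a, rfl⟩)) (H.inv_mem (hSH hg))

theorem supported_singleton [∀ i, MulAction.IsPretransitive (G i) (Δ i)] {t : I} (ht : IsMax t)
    (ω : Above Δ t) : supported G Δ {t} = (singleAt t ω).range := by
  apply le_antisymm
  · rw [← insert_empty_eq]
    refine supported_insert_le isUpperSet_empty (Set.notMem_empty t) ht.Ioi_eq.subset ?_ le_rfl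
    rw [supported_empty]
    exact bot_le
  · rintro _ ⟨a, rfl⟩
    exact singleAt_mem_supported (Set.mem_singleton t) ω a

theorem exists_closure_image_singleton_eq_supported [∀ i, MulAction.IsPretransitive (G i) (Δ i)]
    [∀ i, Nonempty (Δ i)] {t : I} (ht : IsMax t) {a : G t} (ha : Subgroup.closure {a} = ⊤) :
    ∃ x : I → GenWreath G Δ, Subgroup.closure (x '' {t}) = supported G Δ {t} := by
  obtain ⟨ω⟩ : Nonempty (Above Δ t) := inferInstance
  refine ⟨fun _ => singleAt t ω a, ?_⟩
  rw [supported_singleton ht ω, MonoidHom.range_eq_map, ← ha, MonoidHom.map_closure,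
    Set.image_singleton, Set.image_singleton]

/- The conjugate of `a` by `c` is found first over the image of `ω` under `g`, then over each later
point of the orbit, where `singleAt i ω c` commutes with it, until the orbit returns to `ω`. -/
theorem singleAt_conj_mem {H : Subgroup (GenWreath G Δ)} {i : I} {g : GenWreath G Δ}
    (hg : g ∈ supported G Δ (Set.Iic i)ᶜ) {ω : Above Δ i} {a c : G i}
    (hgc : g * singleAt i ω c ∈ H) (ha : singleAt i ω a ∈ H) :
    singleAt i ω (c * a * c⁻¹) ∈ H := by
  have hconj : ∀ z ∈ H, g * (singleAt i ω c * z * (singleAt i ω c)⁻¹) * g⁻¹ ∈ H := fun z hz => by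
    have := H.mul_mem (H.mul_mem hgc hz) (H.inv_mem hgc)
    simpa only [mul_inv_rev, mul_assoc] using this
  refine sameCycle_induction (P := fun ω' => singleAt i ω' (c * a * c⁻¹) ∈ H)
    (Equiv.Perm.SameCycle.refl (g.permAbove i) ω) ?_ fun ω' hω' ih => ?_
  · have := hconj _ ha
    rwa [← map_mul, ← map_inv, ← map_mul, mul_singleAt_mul_inv hg] at this
  · have := hconj _ ih
    rwa [(commute_singleAt_of_ne hω'.symm c (c * a * c⁻¹)).mul_inv_cancel,
      mul_singleAt_mul_inv hg] at this

theorem singleAt_range_le {i : I} [Finite (G i)] {H : Subgroup (GenWreath G Δ)} {g : GenWreath G Δ}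
    (hg : g ∈ supported G Δ (Set.Iic i)ᶜ) {ω : Above Δ i} {c s : G i}
    (hgen : Subgroup.closure {c, s} = ⊤) (hnormal : Subgroup.normalClosure {s} = ⊤)
    (hgc : g * singleAt i ω c ∈ H) (hs : singleAt i ω s ∈ H) : (singleAt i ω).range ≤ H := by
  have htop : H.comap (singleAt i ω) = ⊤ :=
    subgroup_eq_top_of_conj_mem hgen hnormal hs fun a ha => singleAt_conj_mem hg hgc ha
  rw [MonoidHom.range_eq_map, Subgroup.map_le_iff_le_comap, htop]

theorem supported_insert_le_of_closure [∀ i, MulAction.IsPretransitive (G i) (Δ i)] {S : Set I}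
    {i j : I} [Finite (G i)] (hS : IsUpperSet S) (hi : i ∉ S) (hiS : Set.Ioi i ⊆ S) (hj : j ∈ S)
    {x : I → GenWreath G Δ} (hx : Subgroup.closure (x '' S) = supported G Δ S)
    {H : Subgroup (GenWreath G Δ)} {ω : Above Δ i} {c s : G i}
    (hgen : Subgroup.closure {c, s} = ⊤) (hnormal : Subgroup.normalClosure {s} = ⊤)
    (hs : singleAt i ω s ∈ H) (hjH : x j * singleAt i ω c ∈ H)
    (hxH : ∀ k ∈ S, k ≠ j → x k ∈ H) : supported G Δ (insert i S) ≤ H := by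
  have hxj : x j ∈ supported G Δ S := hx ▸ Subgroup.subset_closure (Set.mem_image_of_mem x hj)
  have hrange : (singleAt i ω).range ≤ H :=
    singleAt_range_le (supported_le_supported_compl_Iic hS hi hxj) hgen hnormal hjH hs
  refine supported_insert_le hS hi hiS ?_ hrange
  rw [← hx, Subgroup.closure_le]
  rintro _ ⟨k, hk, rfl⟩
  obtain rfl | hkj := eq_or_ne k j
  · exact (Subgroup.mul_mem_cancel_right H (hrange ⟨c, rfl⟩)).1 hjH
  · exact hxH k hk hkj

theorem exists_closure_image_insert_eq_supported [∀ i, MulAction.IsPretransitive (G i) (Δ i)]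
    [∀ i, Nonempty (Δ i)] {S : Set I} {i : I} [Finite (G i)] (hS : IsUpperSet S) (hi : i ∉ S)
    (hiS : Set.Ioi i ⊆ S) (hne : S.Nonempty) {c s : G i} (hgen : Subgroup.closure {c, s} = ⊤)
    (hnormal : Subgroup.normalClosure {s} = ⊤) {x : I → GenWreath G Δ}
    (hx : Subgroup.closure (x '' S) = supported G Δ S) :
    ∃ y : I → GenWreath G Δ, Subgroup.closure (y '' insert i S) = supported G Δ (insert i S) := by
  classical
  obtain ⟨j, hj⟩ := hne
  obtain ⟨ω⟩ : Nonempty (Above Δ i) := inferInstance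
  let y := Function.update (Function.update x j (x j * singleAt i ω c)) i (singleAt i ω s)
  have hyi : y i = singleAt i ω s := Function.update_self ..
  have hyj : y j = x j * singleAt i ω c := by simp [y, ne_of_mem_of_not_mem hj hi]
  have hyk : ∀ k ∈ S, k ≠ j → y k = x k := fun k hk hkj => by
    simp [y, ne_of_mem_of_not_mem hk hi, hkj]
  refine ⟨y, le_antisymm ?_ ?_⟩
  · have hxS : ∀ k ∈ S, x k ∈ supported G Δ (insert i S) := fun k hk =>
      supported_mono (Set.subset_insert i S)
        (hx ▸ Subgroup.subset_closure (Set.mem_image_of_mem x hk))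
    have hiS' : ∀ a, singleAt i ω a ∈ supported G Δ (insert i S) :=
      singleAt_mem_supported (Set.mem_insert i S) ω
    rw [Subgroup.closure_le]
    rintro _ ⟨k, rfl | hk, rfl⟩
    · exact hyi.symm ▸ hiS' s
    obtain rfl | hkj := eq_or_ne k j
    · exact hyj.symm ▸ mul_mem (hxS k hk) (hiS' c)
    · exact (hyk k hk hkj).symm ▸ hxS k hk
  · have hyH : ∀ k ∈ insert i S, y k ∈ Subgroup.closure (y '' insert i S) := fun k hk =>
      Subgroup.subset_closure (Set.mem_image_of_mem y hk)
    exact supported_insert_le_of_closure hS hi hiS hj hx hgen hnormal (hyi ▸ hyH i (Or.inl rfl))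
      (hyj ▸ hyH j (Or.inr hj)) fun k hk hkj => hyk k hk hkj ▸ hyH k (Or.inr hk)

end Finite

end GenWreath

namespace GenWreath

section LowerBound

variable {I : Type*} [PartialOrder I] [Finite I] {G : I → Type*} {Δ : I → Type*}
  [∀ i, Group (G i)] [∀ i, MulAction (G i) (Δ i)] [∀ i, Finite (Δ i)]

/-- The homomorphism which multiplies the images under `χ` of all values of the component
at `i`. -/
noncomputable def prodHom {A : Type*} [CommGroup A] (i : I) (χ : G i →* A) :
    GenWreath G Δ →* A where
  toFun f := ∏ᶠ ω, χ (f.comp i ω)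
  map_one' := by simp only [one_comp, map_one, finprod_one]
  map_mul' f h := by
    simp only [mul_comp, map_mul]
    rw [finprod_mul_distrib (Set.toFinite _) (Set.toFinite _)]
    exact congrArg (· * _) (finprod_comp_equiv (h.permAbove i) (f := fun ω => χ (f.comp i ω)))

theorem pi_prodHom_surjective [∀ i, Nonempty (Δ i)] {A : I → Type*} [∀ i, CommGroup (A i)]
    {χ : ∀ i, G i →* A i} (hχ : ∀ i, Function.Surjective (χ i)) :
    Function.Surjective (MonoidHom.pi fun i => prodHom (Δ := Δ) i (χ i)) := by
  classical
  intro u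
  choose a ha using fun i => hχ i (u i)
  obtain ⟨p⟩ : Nonempty (∀ i, Δ i) := inferInstance
  refine ⟨⟨fun i => Pi.mulSingle (proj i p) (a i)⟩, funext fun i => ?_⟩
  refine (finprod_eq_single _ (proj i p) fun ω hω => ?_).trans ?_
  · change χ i (Pi.mulSingle (M := fun _ => G i) (proj i p) (a i) ω) = 1
    rw [Pi.mulSingle_eq_of_ne hω, map_one]
  · change χ i (Pi.mulSingle (M := fun _ => G i) (proj i p) (a i) (proj i p)) = u i
    rw [Pi.mulSingle_eq_same, ha]

theorem natCard_le_rank [∀ i, Finite (G i)] [∀ i, Nonempty (Δ i)] {χ : ∀ i, G i →* ℤˣ}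
    (hχ : ∀ i, Function.Surjective (χ i)) : Nat.card I ≤ Group.rank (GenWreath G Δ) :=
  (natCard_le_rank_pi_units_int I).trans (Group.rank_le_of_surjective _ (pi_prodHom_surjective hχ))

end LowerBound

section SymmetricGroups

open Equiv Equiv.Perm

variable {I : Type*} [PartialOrder I] [Finite I] {Δ : I → Type*}

theorem singleAt_range_le_of_isCycle {i t : I} [DecidableEq (Δ t)] [Fintype (Δ t)] (hti : ¬ t ≤ i)
    {ρ : Perm (Δ t)} (hρ : ρ.IsCycle) (hsupp : ρ.support = Finset.univ) {p : ∀ j, Δ j}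
    {τ : Perm (Δ i)} {H : Subgroup (GenWreath (fun i => Perm (Δ i)) Δ)}
    (hswap : singleAt t (proj t p) (swap (ρ (p t)) (ρ (ρ (p t)))) ∈ H)
    (hρτ : singleAt t (proj t p) ρ * singleAt i (proj i p) τ ∈ H) :
    (singleAt (G := fun i => Perm (Δ i)) t (proj t p)).range ≤ H := by
  have htop : H.comap (singleAt (G := fun i => Perm (Δ i)) t (proj t p)) = ⊤ := by
    refine perm_subgroup_eq_top_of_conj_stabilizer_mem hρ hsupp hswap fun π hπ hfix => ?_
    have hcomm := commute_singleAt_of_smul_eq (G := fun i => Perm (Δ i)) hti p hfix τ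
    have hconj := H.mul_mem (H.mul_mem hρτ hπ) (H.inv_mem hρτ)
    rwa [mul_mul_mul_inv_eq_of_commute hcomm.symm, ← map_mul, ← map_inv, ← map_mul] at hconj
  rw [MonoidHom.range_eq_map, Subgroup.map_le_iff_le_comap, htop]

theorem supported_pair_le {i t : I} [DecidableEq (Δ t)] [Fintype (Δ t)] [∀ i, Finite (Δ i)]
    (ht : IsMax t) (hit : i ≠ t) (hi : Set.Ioi i ⊆ {t}) {ρ : Perm (Δ t)} (hρ : ρ.IsCycle)
    (hsupp : ρ.support = Finset.univ) {p : ∀ j, Δ j}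
    (hp : ρ (ρ (p t)) ≠ p t) {c τ : Perm (Δ i)} (hc : Odd (orderOf c))
    (hgen : Subgroup.closure {c, τ} = ⊤) {H : Subgroup (GenWreath (fun i => Perm (Δ i)) Δ)}
    (hσc : singleAt t (proj t p) (swap (ρ (p t)) (ρ (ρ (p t)))) * singleAt i (proj i p) c ∈ H)
    (hρτ : singleAt t (proj t p) ρ * singleAt i (proj i p) τ ∈ H) :
    supported (fun i => Perm (Δ i)) Δ {i, t} ≤ H := by
  set σ := swap (ρ (p t)) (ρ (ρ (p t)))
  have hti : ¬ t ≤ i := fun h => hit (ht.eq_of_le h).symm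
  have hfix : σ (p t) = p t :=
    swap_apply_of_ne_of_ne (mem_support.1 (hsupp ▸ Finset.mem_univ (p t))).symm hp.symm
  have hcomm := commute_singleAt_of_smul_eq (G := fun i => Perm (Δ i)) hti p hfix c
  have hcop : (orderOf (singleAt (G := fun i => Perm (Δ i)) t (proj t p) σ)).Coprime
      (orderOf (singleAt (G := fun i => Perm (Δ i)) i (proj i p) c)) := by
    have hσ : orderOf σ ∣ 2 := orderOf_dvd_of_pow_eq_one (by rw [sq, swap_mul_self])
    exact (hc.coprime_two_left.coprime_dvd_left ((orderOf_map_dvd _ σ).trans hσ)).coprime_dvd_right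
      (orderOf_map_dvd _ c)
  have hσ : singleAt t (proj t p) σ ∈ H := left_mem_of_mul_mem_of_coprime_orderOf hcomm hcop hσc
  have hrange_t := singleAt_range_le_of_isCycle hti hρ hsupp hσ hρτ
  have hrange_i : (singleAt (G := fun i => Perm (Δ i)) i (proj i p)).range ≤ H := by
    rw [MonoidHom.range_eq_map, ← hgen, MonoidHom.map_closure, Subgroup.closure_le]
    rintro _ ⟨_, rfl | rfl, rfl⟩
    · exact (H.mul_mem_cancel_left hσ).1 hσc
    · exact (H.mul_mem_cancel_left (hrange_t ⟨ρ, rfl⟩)).1 hρτ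
  exact supported_insert_le (isUpperSet_singleton_of_isMax ht) hit hi
    ((supported_singleton ht _).trans_le hrange_t) hrange_i

theorem closure_pair_eq_supported {i t : I} [DecidableEq (Δ t)] [Fintype (Δ t)]
    [∀ i, Finite (Δ i)] (ht : IsMax t) (hit : i ≠ t) (hi : Set.Ioi i ⊆ {t}) {ρ : Perm (Δ t)}
    (hρ : ρ.IsCycle) (hsupp : ρ.support = Finset.univ) {p : ∀ j, Δ j}
    (hp : ρ (ρ (p t)) ≠ p t) {c τ : Perm (Δ i)} (hc : Odd (orderOf c))
    (hgen : Subgroup.closure {c, τ} = ⊤) :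
    Subgroup.closure
      {singleAt t (proj t p) (swap (ρ (p t)) (ρ (ρ (p t)))) * singleAt i (proj i p) c,
        singleAt t (proj t p) ρ * singleAt i (proj i p) τ} =
      supported (fun i => Perm (Δ i)) Δ {i, t} := by
  have hmem : ∀ j ∈ ({i, t} : Set I), ∀ a : Perm (Δ j),
      singleAt j (proj j p) a ∈ supported (fun i => Perm (Δ i)) Δ {i, t} := fun j hj =>
    singleAt_mem_supported (G := fun i => Perm (Δ i)) hj (proj j p)
  refine le_antisymm ?_ (supported_pair_le ht hit hi hρ hsupp hp hc hgen
    (Subgroup.mem_closure_of_mem (Or.inl rfl)) (Subgroup.mem_closure_of_mem (Or.inr rfl)))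
  rw [Subgroup.closure_le]
  rintro _ (rfl | rfl)
  all_goals exact mul_mem (hmem t (Or.inr rfl) _) (hmem i (Or.inl rfl) _)

theorem exists_closure_image_pair_eq_supported [∀ i, Finite (Δ i)] [∀ i, Nontrivial (Δ i)]
    {i t : I} (ht : IsMax t) (hit : i ≠ t) (hi : Set.Ioi i ⊆ {t}) :
    ∃ x : I → GenWreath (fun i => Perm (Δ i)) Δ,
      Subgroup.closure (x '' {i, t}) = supported (fun i => Perm (Δ i)) Δ {i, t} := by
  classical
  have := Fintype.ofFinite (Δ t)
  obtain ⟨p⟩ : Nonempty (∀ j, Δ j) := inferInstance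
  obtain ⟨ρ, hρ, hsupp⟩ := exists_isCycle_support_eq_univ (Δ t)
  have hne : ρ (p t) ≠ p t := mem_support.1 (hsupp ▸ Finset.mem_univ (p t))
  by_cases hp : ρ (ρ (p t)) = p t
  · have hρ_top : Subgroup.closure {ρ} = ⊤ := by
      have hgen := closure_cycle_adjacent_swap hρ hsupp (p t)
      rwa [← hρ.eq_swap_of_apply_apply_eq_self hne hp, Set.pair_eq_singleton] at hgen
    obtain ⟨x, hx⟩ :=
      exists_closure_image_singleton_eq_supported (G := fun i => Perm (Δ i)) (Δ := Δ) ht hρ_top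
    obtain ⟨c, s, hgen, hnormal⟩ := exists_closure_pair_eq_top_normalClosure_eq_top (Δ i)
    exact exists_closure_image_insert_eq_supported (isUpperSet_singleton_of_isMax ht) hit hi
      (Set.singleton_nonempty t) hgen hnormal hx
  · obtain ⟨c, τ, hc, hgen⟩ := exists_odd_orderOf_closure_pair_eq_top (Δ i)
    have hpair := closure_pair_eq_supported ht hit hi hρ hsupp hp hc hgen
    set x := singleAt (G := fun i => Perm (Δ i)) t (proj t p) _ * singleAt i (proj i p) c
    set y := singleAt (G := fun i => Perm (Δ i)) t (proj t p) ρ * singleAt i (proj i p) τ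
    refine ⟨Function.update (fun _ => y) i x, ?_⟩
    rwa [Set.image_pair, Function.update_self, Function.update_of_ne hit.symm]

theorem exists_closure_image_eq_supported [∀ i, Finite (Δ i)] [∀ i, Nontrivial (Δ i)] {S : Set I}
    (hS : IsUpperSet S) (hS2 : S.Nontrivial) : ∃ x : I → GenWreath (fun i => Perm (Δ i)) Δ,
      Subgroup.closure (x '' S) = supported (fun i => Perm (Δ i)) Δ S := by
  induction S using WellFoundedLT.induction with
  | ind S ih =>
    obtain ⟨i, hi⟩ := (Set.toFinite S).exists_minimal hS2.nonempty
    have hupper : IsUpperSet (S \ {i}) := hS.erase fun b hb hbi => hi.eq_of_le hb hbi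
    have hIoi : Set.Ioi i ⊆ S \ {i} := fun j hj => ⟨hS hj.le hi.prop, hj.ne'⟩
    have hnotMem : i ∉ S \ {i} := fun h => h.2 rfl
    have hinsert : insert i (S \ {i}) = S := Set.insert_sdiff_self_of_mem hi.prop
    have hlt : S \ {i} < S := Set.sdiff_singleton_ssubset.2 hi.prop
    have hne : (S \ {i}).Nonempty := (hS2.exists_ne i).imp fun _ h => h
    rw [← hinsert]
    obtain ⟨t, ht⟩ | hntriv := hne.exists_eq_singleton_or_nontrivial
    · rw [ht] at hupper hIoi hnotMem ⊢
      exact exists_closure_image_pair_eq_supported (fun _ h => (hupper h rfl).le) hnotMem hIoi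
    · obtain ⟨x, hx⟩ := ih _ hlt hupper hntriv
      obtain ⟨c, s, hgen, hnormal⟩ := exists_closure_pair_eq_top_normalClosure_eq_top (Δ i)
      exact exists_closure_image_insert_eq_supported hupper hnotMem hIoi hne hgen hnormal hx

end SymmetricGroups

end GenWreath

theorem theorem1 {I : Type*} [PartialOrder I] [Finite I] (hI : 2 ≤ Nat.card I)
    (Δ : I → Type*) [∀ i, Finite (Δ i)] [∀ i, Nontrivial (Δ i)] :
    Group.rank (GenWreath (fun i => Equiv.Perm (Δ i)) Δ) = Nat.card I := by
  classical
  have := Finite.one_lt_card_iff_nontrivial.1 hI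
  have := fun i => Fintype.ofFinite (Δ i)
  refine le_antisymm ?_ (GenWreath.natCard_le_rank fun i => Equiv.Perm.sign_surjective (Δ i))
  obtain ⟨x, hx⟩ := GenWreath.exists_closure_image_eq_supported (Δ := Δ) isUpperSet_univ
    Set.nontrivial_univ
  rw [Set.image_univ, GenWreath.supported_univ] at hx
  exact rank_le_natCard_of_closure_range_eq_top hx
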